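/- There is an absolute constant $C$ such that for every $n \ge 0$ and every total Boolean function $f:\{0,1\}^n\to\{0,1\}$, $$D(f) \le C\cdot Q(f)^4 .$$ Here $D(f)$ is the deterministic query complexity of $f$: the minimum, over all deterministic algorithms (decision trees) that compute $f(x)$ for every $x\in\{0,1\}^n$ by querying bits of $x$, of the maximum number of queries made over all inputs $x$. And $Q(f)$ is the bounded-error quantum query complexity of $f$: the minimum $T$ for which some $T$-query quantum algorithm outputs $f(x)$ with probability at least $2/3$ on every input $x\in\{0,1\}^n$. A $T$-query quantum algorithm acts on basis states $|i,b,z\rangle$, where $i\in\{1,\dots,n\}\cup\{\mathrm{none}\}$ is a query index, $b\in\{0,1\}$ is a target bit, and $z$ ranges over the bit strings of a finite workspace. It applies $U_T O_x U_{T-1} O_x\cdots O_x U_0$ to a fixed initial basis state, where the unitaries $U_t$ do not depend on $x$ and $O_x|i,b,z\rangle=|i,b\oplus x_i,z\rangle$ (with $O_x$ acting as the identity for $i=\mathrm{none}$), then measures in the computational basis and outputs a bit determined by the outcome. -/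

import Mathlib

namespace QueryComplexity

/-! ### Deterministic query algorithms -/

/-- A deterministic query algorithm (decision tree) on `n`-bit inputs: it either stops with an
output bit, or queries the bit `i` and continues with the first subtree if the answer is `false`
and with the second one if the answer is `true`. -/
inductive DecisionTree (n : ℕ) : Type
  | leaf (b : Bool) : DecisionTree n
  | query (i : Fin n) (t₀ t₁ : DecisionTree n) : DecisionTree n

/-- The output of a decision tree on the input `x`. -/
def DecisionTree.eval {n : ℕ} : DecisionTree n → (Fin n → Bool) → Bool
  | .leaf b, _ => b
  | .query i t₀ t₁, x => if x i then t₁.eval x else t₀.eval x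

/-- The number of queries that a decision tree makes on the input `x`. -/
def DecisionTree.cost {n : ℕ} : DecisionTree n → (Fin n → Bool) → ℕ
  | .leaf _, _ => 0
  | .query i t₀ t₁, x => (if x i then t₁.cost x else t₀.cost x) + 1

/-- Some deterministic algorithm computes `f`, making at most `T` queries on every input. -/
def DetComputable {n : ℕ} (f : (Fin n → Bool) → Bool) (T : ℕ) : Prop :=
  ∃ t : DecisionTree n, (∀ x, t.eval x = f x) ∧ ∀ x, t.cost x ≤ T

/-- The deterministic query complexity `D(f)`. -/
noncomputable def D {n : ℕ} (f : (Fin n → Bool) → Bool) : ℕ :=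
  sInf {T : ℕ | DetComputable f T}

/-! ### Quantum query algorithms -/

/-- Labels `(i, b, z)` of the computational basis states: an index register `i`, where `none` is
an idle value, a target bit `b` for the answer to a query, and a workspace of `w` bits. -/
abbrev Basis (n w : ℕ) : Type := Option (Fin n) × Bool × (Fin w → Bool)

/-- The query unitary `|i, b, z⟩ ↦ |i, b ⊕ xᵢ, z⟩`, acting as the identity for `i = none`.
As this permutation of the basis is an involution, the amplitude of the image of `ψ` at
`(i, b, z)` is the amplitude of `ψ` at `(i, b ⊕ xᵢ, z)`. -/
def oracle {n w : ℕ} (x : Fin n → Bool) (ψ : Basis n w → ℂ) : Basis n w → ℂ :=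
  fun s => ψ (s.1, xor s.2.1 (s.1.elim false x), s.2.2)

/-- A quantum query algorithm on `n`-bit inputs, with a workspace of `w` qubits, given by its
input-independent unitaries and by the output bit assigned to each outcome of the final
measurement in the computational basis. -/
structure QuantumAlgorithm (n w : ℕ) where
  /-- `U t` is the unitary applied after the `t`-th query (`U 0` comes before all queries). -/
  U : ℕ → Matrix.unitaryGroup (Basis n w) ℂ
  /-- The output bit for each measurement outcome. -/
  out : Basis n w → Bool

/-- The initial state `|none, 0, 0 ⋯ 0⟩`. -/
def initState (n w : ℕ) : Basis n w → ℂ :=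
  Pi.single (none, false, fun _ => false) 1

/-- The state `U_T O_x U_{T-1} O_x ⋯ O_x U_0 |none, 0, 0 ⋯ 0⟩` after `T` queries. -/
def QuantumAlgorithm.state {n w : ℕ} (A : QuantumAlgorithm n w) (x : Fin n → Bool) :
    ℕ → Basis n w → ℂ
  | 0 => Matrix.mulVec (A.U 0).1 (initState n w)
  | T + 1 => Matrix.mulVec (A.U (T + 1)).1 (oracle x (A.state x T))

/-- The probability that the algorithm, run with `T` queries on the input `x`, outputs `b`. -/
noncomputable def QuantumAlgorithm.outputProb {n w : ℕ} (A : QuantumAlgorithm n w) (T : ℕ)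
    (x : Fin n → Bool) (b : Bool) : ℝ :=
  ∑ s : Basis n w, if A.out s = b then ‖A.state x T s‖ ^ 2 else 0

/-- Some quantum algorithm making `T` queries computes `f` with bounded error, i.e. with success
probability at least `2/3` on every input. -/
def QuantumComputable {n : ℕ} (f : (Fin n → Bool) → Bool) (T : ℕ) : Prop :=
  ∃ (w : ℕ) (A : QuantumAlgorithm n w), ∀ x, 2 / 3 ≤ A.outputProb T x (f x)

/-- The bounded-error quantum query complexity `Q(f)`. -/
noncomputable def Q {n : ℕ} (f : (Fin n → Bool) → Bool) : ℕ :=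
  sInf {T : ℕ | QuantumComputable f T}

/-! ### Both infima are over non-empty sets: `n` queries suffice -/

/-- The tree that queries the indices of a list, storing the answers in `y`. -/
def DecisionTree.full {n : ℕ} (f : (Fin n → Bool) → Bool) :
    List (Fin n) → (Fin n → Bool) → DecisionTree n
  | [], y => .leaf (f y)
  | i :: l, y => .query i (full f l (Function.update y i false))
      (full f l (Function.update y i true))

theorem DecisionTree.eval_full {n : ℕ} (f : (Fin n → Bool) → Bool) (x : Fin n → Bool)
    (l : List (Fin n)) : ∀ y : Fin n → Bool,
    (DecisionTree.full f l y).eval x = f (fun j => if j ∈ l then x j else y j) := by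
  induction l with
  | nil => intro y; simp [DecisionTree.full, DecisionTree.eval]
  | cons i l ih =>
    intro y
    have key : ∀ b, x i = b → f (fun j => if j ∈ l then x j else Function.update y i b j)
        = f (fun j => if j ∈ i :: l then x j else y j) := by
      intro b hb
      congr 1
      funext j
      by_cases hj : j = i
      · subst hj; simp [hb]
      · simp [hj]
    simp only [DecisionTree.full, DecisionTree.eval, ih]
    cases hx : x i
    · simpa using key false hx
    · simpa using key true hx

theorem DecisionTree.cost_full {n : ℕ} (f : (Fin n → Bool) → Bool) (x : Fin n → Bool)
    (l : List (Fin n)) : ∀ y : Fin n → Bool, (DecisionTree.full f l y).cost x = l.length := by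
  induction l with
  | nil => intro y; simp [DecisionTree.full, DecisionTree.cost]
  | cons i l ih => intro y; simp [DecisionTree.full, DecisionTree.cost, ih]

theorem detComputable_self {n : ℕ} (f : (Fin n → Bool) → Bool) : DetComputable f n :=
  ⟨DecisionTree.full f (List.finRange n) fun _ => false,
    fun x => by simp [DecisionTree.eval_full], fun x => by simp [DecisionTree.cost_full]⟩

/-- The unitary that permutes the basis states by `σ`. -/
noncomputable def permUnitary {n w : ℕ} (σ : Equiv.Perm (Basis n w)) :
    Matrix.unitaryGroup (Basis n w) ℂ :=
  ⟨σ⁻¹.permMatrix ℂ, by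
    rw [Matrix.mem_unitaryGroup_iff, Matrix.star_eq_conjTranspose, Matrix.conjTranspose_permMatrix,
      ← Matrix.permMatrix_mul]
    simp⟩

theorem permUnitary_mulVec_single {n w : ℕ} (σ : Equiv.Perm (Basis n w)) (s : Basis n w) :
    Matrix.mulVec (permUnitary σ).1 (Pi.single s 1) = Pi.single (σ s) 1 := by
  rw [permUnitary, Matrix.permMatrix_mulVec]
  funext s'
  by_cases h : s' = σ s
  · subst h; simp
  · have h' : σ⁻¹ s' ≠ s := by
      rintro rfl
      simp at h
    rw [Function.comp_apply, Pi.single_eq_of_ne h', Pi.single_eq_of_ne h]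

theorem oracle_single {n w : ℕ} (x : Fin n → Bool) (s : Basis n w) :
    oracle x (Pi.single s 1) = Pi.single (s.1, xor s.2.1 (s.1.elim false x), s.2.2) 1 := by
  funext s'
  obtain ⟨i, b, z⟩ := s
  obtain ⟨i', b', z'⟩ := s'
  simp only [oracle, Pi.single_apply, Prod.mk.injEq]
  by_cases hi : i' = i
  · subst hi
    cases h : i'.elim false x <;> cases b <;> cases b' <;> simp
  · simp [hi]

/-- The index queried at time `t` when all bits are queried in order. -/
def idx (n t : ℕ) : Option (Fin n) := if h : t < n then some ⟨t, h⟩ else none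

/-- Exchange the target bit with the workspace bit `i`. -/
def exchange {n : ℕ} (i : Fin n) : Equiv.Perm (Basis n n) :=
  Function.Involutive.toPerm (fun s => (s.1, s.2.2 i, Function.update s.2.2 i s.2.1))
    (fun s => by simp)

/-- Exchange two values of the index register. -/
def swapIdx {n : ℕ} (i j : Option (Fin n)) : Equiv.Perm (Basis n n) :=
  (Equiv.swap i j).prodCongr (Equiv.refl _)

/-- The algorithm that queries all bits in order and then outputs the value of `f`. -/
noncomputable def readAll {n : ℕ} (f : (Fin n → Bool) → Bool) : QuantumAlgorithm n n where
  U
    | 0 => permUnitary (swapIdx none (idx n 0))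
    | t + 1 => permUnitary (if h : t < n then
        (exchange ⟨t, h⟩).trans (swapIdx (idx n t) (idx n (t + 1))) else 1)
  out s := f s.2.2

theorem readAll_state {n : ℕ} (f : (Fin n → Bool) → Bool) (x : Fin n → Bool) (t : ℕ) (ht : t ≤ n) :
    (readAll f).state x t =
      Pi.single (idx n t, false, fun j => if j.1 < t then x j else false) 1 := by
  induction t with
  | zero =>
    rw [QuantumAlgorithm.state, initState]
    simp only [readAll, permUnitary_mulVec_single]
    simp [swapIdx]
  | succ t ih =>
    have h : t < n := ht
    rw [QuantumAlgorithm.state, ih h.le, oracle_single]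
    simp only [readAll, permUnitary_mulVec_single]
    congr 1
    have hi : idx n t = some ⟨t, h⟩ := by simp [idx, h]
    rw [dif_pos h, hi]
    refine Prod.ext (Equiv.swap_apply_left _ _) (Prod.ext ?_ ?_)
    · exact if_neg (lt_irrefl t)
    · change Function.update (fun j : Fin n => if j.1 < t then x j else false) ⟨t, h⟩
        (xor false (x ⟨t, h⟩)) = fun j : Fin n => if j.1 < t + 1 then x j else false
      funext j
      by_cases hj : j = ⟨t, h⟩
      · subst hj; simp
      · have hne : j.1 ≠ t := fun e => hj (Fin.ext e)
        have hlt : j.1 < t + 1 ↔ j.1 < t := by omega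
        simp [hj, hlt]

theorem quantumComputable_self {n : ℕ} (f : (Fin n → Bool) → Bool) : QuantumComputable f n := by
  refine ⟨n, readAll f, fun x => ?_⟩
  rw [QuantumAlgorithm.outputProb, readAll_state f x n le_rfl]
  have hs : (readAll f).out (idx n n, false, fun j : Fin n => if j.1 < n then x j else false)
      = f x := by
    simp [readAll]
  rw [Finset.sum_eq_single (idx n n, false, fun j : Fin n => if j.1 < n then x j else false)]
  · rw [if_pos hs]; norm_num
  · intro s _ hne; rw [Pi.single_eq_of_ne hne]; simp
  · simp

theorem detComputable_D {n : ℕ} (f : (Fin n → Bool) → Bool) : DetComputable f (D f) :=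
  Nat.sInf_mem (s := {T : ℕ | DetComputable f T}) ⟨n, detComputable_self f⟩

theorem quantumComputable_Q {n : ℕ} (f : (Fin n → Bool) → Bool) : QuantumComputable f (Q f) :=
  Nat.sInf_mem (s := {T : ℕ | QuantumComputable f T}) ⟨n, quantumComputable_self f⟩

end QueryComplexity

/-!
The proof combines `D(f) ≤ bs(f) * deg(f)` with `bs(f) = O(Q(f)²)` and `deg(f) = O(Q(f)²)`.

* Take a maximal monomial `M` of the multilinear polynomial of a non-constant `f`. Whatever the bits
  outside of `M` are, `f` is not constant in the bits of `M`, so every input has a sensitive block inside `M`.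
  Hence querying all of `M` decreases the block sensitivity of `f`, and repeating this gives a
  decision tree of depth `bs(f) * deg(f)` (`detComputable_mul`). Polynomials are avoided by working
  with the alternating sums `altSum f M` of `(-1) ^ f` over subcubes, which, for non-empty `M`, do
  not vanish on some subcube exactly if `M` is contained in a monomial.

* For a maximal monomial `M`, the function `(-1) ^ f * altSum f M` is positive on more than half of
  the cube, and edges in the directions of `M` between points of that set are sensitive. The
  hypercube in the directions of `M` has a signed adjacency operator with square `|M|`. One of its
  two eigenspaces has at least half of the full dimension, so it contains a vector supported on this
  set, and its absolute value shows that the graph of sensitive edges has spectral norm at least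
  `√|M|` (`IsMaximalMonomial.exists_weights`). This is Huang's proof of the sensitivity conjecture.

* The adversary method bounds how fast a quantum algorithm can separate the states of two inputs
  that differ only in a block `B`, in terms of the weight with which it queries `B`
  (`QuantumAlgorithm.le_sum_queryWeight`). Summed over the disjoint sensitive blocks of an input
  this gives `bs(f) = O(Q(f)²)`, and summed over the sensitive edges with the weights above it
  gives `√|M| = O(Q(f))`.
-/

namespace QueryComplexity

open Finset

variable {n : ℕ}

/-! ### Flips and alternating sums on the Boolean cube -/

/-- The input `x` with the bits in the block `B` flipped. -/
def flipOn (x : Fin n → Bool) (B : Finset (Fin n)) : Fin n → Bool :=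
  fun i => xor (x i) (decide (i ∈ B))

theorem flipOn_empty (x : Fin n → Bool) : flipOn x ∅ = x := by
  funext i; simp [flipOn]

theorem flipOn_flipOn_self (x : Fin n → Bool) (B : Finset (Fin n)) :
    flipOn (flipOn x B) B = x := by
  funext i; simp [flipOn]

theorem flipOn_comm (x : Fin n → Bool) (B B' : Finset (Fin n)) :
    flipOn (flipOn x B) B' = flipOn (flipOn x B') B := by
  funext i; exact Bool.xor_right_comm _ _ _

theorem flipOn_insert (x : Fin n → Bool) {i : Fin n} {B : Finset (Fin n)} (hi : i ∉ B) :
    flipOn x (insert i B) = flipOn (flipOn x {i}) B := by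
  funext j
  by_cases hj : j = i
  · subst hj; simp [flipOn, hi]
  · simp [flipOn, hj]

theorem exists_flipOn_eq (x y : Fin n → Bool) : ∃ B, flipOn x B = y :=
  ⟨univ.filter fun i => x i ≠ y i, by
    funext i; cases hx : x i <;> cases hy : y i <;> simp [flipOn, hx, hy]⟩

/-- Flipping a block is a permutation of the cube. -/
theorem sum_flipOn (g : (Fin n → Bool) → ℝ) (B : Finset (Fin n)) :
    ∑ x, g (flipOn x B) = ∑ x, g x :=
  Equiv.sum_comp
    (Function.Involutive.toPerm (fun x => flipOn x B) fun x => flipOn_flipOn_self x B) g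

/-- The sign `(-1) ^ b`. -/
def sgn (b : Bool) : ℝ := if b then -1 else 1

theorem sgn_ne_zero (b : Bool) : sgn b ≠ 0 := by cases b <;> simp [sgn]

theorem sgn_mul_self (b : Bool) : sgn b * sgn b = 1 := by cases b <;> simp [sgn]

theorem sgn_injective : Function.Injective sgn := by
  intro a b; cases a <;> cases b <;> norm_num [sgn]

theorem sgn_xor (a b : Bool) : sgn (xor a b) = sgn a * sgn b := by
  cases a <;> cases b <;> norm_num [sgn]

/-- The alternating sum of `(-1) ^ f` over the subcube through `x` in the directions `M`. For
`M = {i₁, …, iₖ}` it is the iterated difference of `(-1) ^ f` in these directions; it is non-zero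
for some `x` exactly if some monomial of the multilinear polynomial of `f` contains `M`, except
that for `M = ∅` it is never zero. -/
noncomputable def altSum (f : (Fin n → Bool) → Bool) (M : Finset (Fin n)) (x : Fin n → Bool) : ℝ :=
  ∑ S ∈ M.powerset, (-1) ^ #S * sgn (f (flipOn x S))

theorem altSum_empty (f : (Fin n → Bool) → Bool) (x : Fin n → Bool) :
    altSum f ∅ x = sgn (f x) := by
  simp [altSum, flipOn_empty]

theorem altSum_insert (f : (Fin n → Bool) → Bool) {M : Finset (Fin n)} {i : Fin n} (hi : i ∉ M)
    (x : Fin n → Bool) :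
    altSum f (insert i M) x = altSum f M x - altSum f M (flipOn x {i}) := by
  rw [altSum, sum_powerset_insert hi, sub_eq_add_neg, altSum, altSum, ← sum_neg_distrib]
  congr 1
  refine sum_congr rfl fun S hS => ?_
  have hiS : i ∉ S := fun h => hi (mem_powerset.1 hS h)
  rw [card_insert_of_notMem hiS, flipOn_insert x hiS]
  ring

theorem altSum_eq_sub (f : (Fin n → Bool) → Bool) {M : Finset (Fin n)} {i : Fin n} (hi : i ∈ M)
    (x : Fin n → Bool) :
    altSum f M x = altSum f (M.erase i) x - altSum f (M.erase i) (flipOn x {i}) := by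
  rw [← altSum_insert f (notMem_erase i M), insert_erase hi]

theorem altSum_flipOn_singleton (f : (Fin n → Bool) → Bool) {M : Finset (Fin n)} {i : Fin n}
    (hi : i ∈ M) (x : Fin n → Bool) : altSum f M (flipOn x {i}) = -altSum f M x := by
  rw [altSum_eq_sub f hi, altSum_eq_sub f hi x, flipOn_flipOn_self]
  ring

theorem altSum_flipOn_of_subset (f : (Fin n → Bool) → Bool) {M : Finset (Fin n)}
    {S : Finset (Fin n)} (hS : S ⊆ M) (x : Fin n → Bool) :
    altSum f M (flipOn x S) = (-1) ^ #S * altSum f M x := by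
  induction S using Finset.induction_on generalizing x with
  | empty => simp [flipOn_empty]
  | insert i S hi ih =>
    rw [flipOn_insert x hi, ih (fun j hj => hS (mem_insert_of_mem hj)),
      altSum_flipOn_singleton f (hS (mem_insert_self i S)), card_insert_of_notMem hi]
    ring

/-- Every subcube in the directions `M` on which the alternating sum does not vanish has two
points where `f` differs. -/
theorem exists_sensitive_subset {f : (Fin n → Bool) → Bool} {M : Finset (Fin n)}
    (hM : M.Nonempty) {x : Fin n → Bool} (hx : altSum f M x ≠ 0) :
    ∃ B ⊆ M, f (flipOn x B) ≠ f x := by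
  by_contra! h
  refine hx ?_
  have : altSum f M x = (∑ S ∈ M.powerset, (-1 : ℝ) ^ #S) * sgn (f x) := by
    rw [altSum, sum_mul]
    exact sum_congr rfl fun S hS => by rw [h S (mem_powerset.1 hS)]
  have h0 : (∑ S ∈ M.powerset, (-1 : ℝ) ^ #S) = 0 := by
    exact_mod_cast sum_powerset_neg_one_pow_card_of_nonempty hM
  rw [this, h0, zero_mul]

/-- `M` is a maximal set of directions in which some alternating sum of `f` does not vanish. If
`M` is non-empty, this says that `M` is an inclusion-maximal monomial of the multilinear
polynomial of `f`. -/
def IsMaximalMonomial (f : (Fin n → Bool) → Bool) (M : Finset (Fin n)) : Prop :=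
  Maximal (fun M => ∃ x, altSum f M x ≠ 0) M

theorem exists_isMaximalMonomial_superset {f : (Fin n → Bool) → Bool} {M : Finset (Fin n)}
    {x : Fin n → Bool} (hx : altSum f M x ≠ 0) : ∃ M', M ⊆ M' ∧ IsMaximalMonomial f M' :=
  Finite.exists_le_maximal (p := fun M => ∃ x, altSum f M x ≠ 0) ⟨x, hx⟩

theorem IsMaximalMonomial.altSum_flipOn_of_notMem {f : (Fin n → Bool) → Bool}
    {M : Finset (Fin n)} (hM : IsMaximalMonomial f M) {i : Fin n} (hi : i ∉ M)
    (x : Fin n → Bool) : altSum f M (flipOn x {i}) = altSum f M x := by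
  by_contra hne
  refine hi (hM.2 (y := insert i M) ⟨x, ?_⟩ (subset_insert i M) (mem_insert_self i M))
  rw [altSum_insert f hi]
  exact sub_ne_zero.2 fun h => hne h.symm

/-- Directions inside `M` change the sign of the alternating sum, and directions outside of a
maximal `M` do not change it at all. -/
theorem IsMaximalMonomial.abs_altSum_eq {f : (Fin n → Bool) → Bool}
    {M : Finset (Fin n)} (hM : IsMaximalMonomial f M) (x y : Fin n → Bool) :
    |altSum f M x| = |altSum f M y| := by
  obtain ⟨B, rfl⟩ := exists_flipOn_eq x y
  induction B using Finset.induction_on generalizing x with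
  | empty => rw [flipOn_empty]
  | insert i B hi ih =>
    rw [flipOn_insert x hi, ← ih]
    by_cases h : i ∈ M
    · rw [altSum_flipOn_singleton f h, abs_neg]
    · rw [hM.altSum_flipOn_of_notMem h]

theorem IsMaximalMonomial.altSum_ne_zero {f : (Fin n → Bool) → Bool}
    {M : Finset (Fin n)} (hM : IsMaximalMonomial f M) (x : Fin n → Bool) : altSum f M x ≠ 0 := by
  obtain ⟨y, hy⟩ := hM.1
  rwa [← abs_pos, hM.abs_altSum_eq x y, abs_pos]

/-- If the empty set is maximal, all first differences of `f` vanish. -/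
theorem IsMaximalMonomial.eq_of_empty {f : (Fin n → Bool) → Bool}
    (hM : IsMaximalMonomial f ∅) (x y : Fin n → Bool) : f x = f y := by
  obtain ⟨B, rfl⟩ := exists_flipOn_eq x y
  induction B using Finset.induction_on generalizing x with
  | empty => rw [flipOn_empty]
  | insert i B hi ih =>
    rw [flipOn_insert x hi, ← ih]
    have := hM.altSum_flipOn_of_notMem (notMem_empty i) x
    rw [altSum_empty, altSum_empty] at this
    exact (sgn_injective this).symm

/-! ### Block sensitivity, restrictions and decision trees -/

/-- `f` has block sensitivity at most `b`: no input has more than `b` disjoint blocks each of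
whose flips changes the value of `f`. -/
def BlockSensitivityLE (f : (Fin n → Bool) → Bool) (b : ℕ) : Prop :=
  ∀ (k : ℕ) (x : Fin n → Bool) (B : Fin k → Finset (Fin n)),
    Pairwise (fun i j => Disjoint (B i) (B j)) → (∀ j, f (flipOn x (B j)) ≠ f x) → k ≤ b

/-- The restriction of `f` obtained by fixing the bits in `M` to their values in `z`, regarded as
a function of all `n` bits. -/
def restrict (f : (Fin n → Bool) → Bool) (M : Finset (Fin n)) (z : Fin n → Bool) :
    (Fin n → Bool) → Bool :=
  fun y => f (M.piecewise z y)

theorem piecewise_flipOn (M B : Finset (Fin n)) (z y : Fin n → Bool) :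
    M.piecewise z (flipOn y B) = flipOn (M.piecewise z y) (B \ M) := by
  funext i
  by_cases hi : i ∈ M <;> simp [flipOn, hi]

theorem altSum_restrict_ne_zero {f : (Fin n → Bool) → Bool} {M M' : Finset (Fin n)}
    {z y : Fin n → Bool} (h : altSum (restrict f M z) M' y ≠ 0) :
    altSum f M' (M.piecewise z y) ≠ 0 := by
  -- The restriction does not depend on the bits in `M`, so its differences along them vanish.
  have hdisj : Disjoint M' M := by
    rw [disjoint_left]
    intro i hi' hi
    refine h ?_
    rw [altSum_eq_sub _ hi', sub_eq_zero, altSum, altSum]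
    refine sum_congr rfl fun S _ => ?_
    rw [flipOn_comm, restrict, restrict, piecewise_flipOn M {i},
      sdiff_eq_empty_iff_subset.2 (singleton_subset_iff.2 hi), flipOn_empty]
  have : altSum f M' (M.piecewise z y) = altSum (restrict f M z) M' y := by
    refine sum_congr rfl fun S hS => ?_
    rw [restrict, piecewise_flipOn,
      sdiff_eq_self_of_disjoint (hdisj.mono_left (mem_powerset.1 hS))]
  rwa [this]

/-- Fixing the bits in a maximal monomial decreases the block sensitivity, because every input has
a sensitive block inside the monomial, which is disjoint from all blocks of free bits. -/
theorem IsMaximalMonomial.blockSensitivityLE_restrict {f : (Fin n → Bool) → Bool}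
    {M : Finset (Fin n)} (hM : IsMaximalMonomial f M) (hne : M.Nonempty) {b : ℕ}
    (hb : BlockSensitivityLE f (b + 1)) (z : Fin n → Bool) :
    BlockSensitivityLE (restrict f M z) b := by
  intro k y B hB hs
  obtain ⟨B₀, hB₀, hs₀⟩ := exists_sensitive_subset hne (hM.altSum_ne_zero (M.piecewise z y))
  have key := hb (k + 1) (M.piecewise z y) (Fin.cons B₀ fun j => B j \ M) ?_ ?_
  · omega
  · have h0 : ∀ j, Disjoint B₀ (B j \ M) := fun j => disjoint_sdiff.mono_left hB₀
    intro i j hij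
    refine Fin.cases (fun hij => ?_) (fun i hij => ?_) i hij
    · refine Fin.cases (fun h => absurd rfl h) (fun j _ => ?_) j hij
      simpa using h0 j
    · refine Fin.cases (fun _ => ?_) (fun j hij => ?_) j hij
      · simpa using (h0 i).symm
      · simpa using (hB fun e => hij (congrArg Fin.succ e)).mono sdiff_subset sdiff_subset
  · refine Fin.cases (by simpa using hs₀) fun j => ?_
    simpa [restrict, piecewise_flipOn] using hs j

theorem detComputable_of_update {f : (Fin n → Bool) → Bool} {T : ℕ} (i : Fin n)
    (h : ∀ b, DetComputable (fun y => f (Function.update y i b)) T) :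
    DetComputable f (T + 1) := by
  obtain ⟨t₀, h₀, c₀⟩ := h false
  obtain ⟨t₁, h₁, c₁⟩ := h true
  refine ⟨.query i t₀ t₁, fun x => ?_, fun x => ?_⟩
  · cases hx : x i
    · simp only [DecisionTree.eval, hx, h₀]
      simp [← hx]
    · simp only [DecisionTree.eval, hx, h₁]
      simp [← hx]
  · cases hx : x i
    · simpa [DecisionTree.cost, hx] using c₀ x
    · simpa [DecisionTree.cost, hx] using c₁ x

theorem detComputable_of_restrict {f : (Fin n → Bool) → Bool} (M : Finset (Fin n)) {T : ℕ}
    (h : ∀ z, DetComputable (restrict f M z) T) : DetComputable f (T + #M) := by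
  induction M using Finset.induction_on generalizing T with
  | empty =>
    have h0 : restrict f ∅ (fun _ => false) = f := by funext y; simp [restrict]
    simpa [h0] using h fun _ => false
  | insert i M hi ih =>
    rw [card_insert_of_notMem hi, add_comm #M 1, ← add_assoc]
    refine ih fun z => detComputable_of_update i fun b => ?_
    convert h (Function.update z i b) using 1
    funext y
    simp only [restrict]
    congr 1
    funext j
    by_cases hj : j = i
    · subst hj; simp [hi]
    · by_cases hjM : j ∈ M <;> simp [hj, hjM]

/-- The bound `D(f) ≤ bs(f) * deg(f)`: the tree repeatedly queries a whole maximal monomial of the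
current restriction, and each round decreases the block sensitivity. -/
theorem detComputable_mul {d : ℕ} (b : ℕ) (f : (Fin n → Bool) → Bool)
    (hd : ∀ M x, altSum f M x ≠ 0 → #M ≤ d) (hb : BlockSensitivityLE f b) :
    DetComputable f (b * d) := by
  have hx₀ : altSum f ∅ (fun _ => false) ≠ 0 := by
    rw [altSum_empty]; exact sgn_ne_zero _
  induction b generalizing f with
  | zero =>
    obtain ⟨M, -, hM⟩ := exists_isMaximalMonomial_superset hx₀
    rcases M.eq_empty_or_nonempty with rfl | hne
    · exact ⟨.leaf (f fun _ => false), fun x => hM.eq_of_empty _ _, fun x => Nat.zero_le _⟩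
    · obtain ⟨B, -, hB⟩ := exists_sensitive_subset hne (hM.altSum_ne_zero fun _ => false)
      have := hb 1 (fun _ => false) (fun _ => B)
        (fun i j hij => absurd (Subsingleton.elim i j) hij) (fun _ => hB)
      omega
  | succ b ih =>
    obtain ⟨M, -, hM⟩ := exists_isMaximalMonomial_superset hx₀
    rcases M.eq_empty_or_nonempty with rfl | hne
    · exact ⟨.leaf (f fun _ => false), fun x => hM.eq_of_empty _ _, fun x => Nat.zero_le _⟩
    · obtain ⟨t, ht, hc⟩ := detComputable_of_restrict M fun z =>
        ih (restrict f M z) (fun M' y h => hd M' _ (altSum_restrict_ne_zero h))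
          (hM.blockSensitivityLE_restrict hne hb z) (by rw [altSum_empty]; exact sgn_ne_zero _)
      refine ⟨t, ht, fun x => (hc x).trans ?_⟩
      rw [add_mul, one_mul]
      exact Nat.add_le_add_left (hd M _ (hM.altSum_ne_zero fun _ => false)) _

/-! ### The signed hypercube and sensitive edges -/

/-- The Jordan–Wigner sign `(-1) ^ (x₀ + ⋯ + xᵢ₋₁)` of the edge at `x` in direction `i`. -/
noncomputable def edgeSign (i : Fin n) (x : Fin n → Bool) : ℝ := ∏ k ∈ Iio i, sgn (x k)

theorem edgeSign_mul_self (i : Fin n) (x : Fin n → Bool) : edgeSign i x * edgeSign i x = 1 := by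
  rw [edgeSign, ← prod_mul_distrib]
  exact prod_eq_one fun k _ => sgn_mul_self _

theorem abs_edgeSign (i : Fin n) (x : Fin n → Bool) : |edgeSign i x| = 1 := by
  have h := edgeSign_mul_self i x
  rw [← abs_mul_abs_self] at h
  nlinarith [abs_nonneg (edgeSign i x)]

theorem edgeSign_flipOn (i j : Fin n) (x : Fin n → Bool) :
    edgeSign i (flipOn x {j}) = if j < i then -edgeSign i x else edgeSign i x := by
  have : edgeSign i (flipOn x {j}) = edgeSign i x * ∏ k ∈ Iio i, if k = j then -1 else 1 := by
    rw [edgeSign, edgeSign, ← prod_mul_distrib]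
    refine prod_congr rfl fun k _ => ?_
    rw [flipOn, sgn_xor]
    simp [sgn]
  rw [this, prod_ite_eq']
  split_ifs with h1 h2 h2 <;> simp_all

/-- The signed adjacency operator of the hypercube graph with edges in the directions `M`. -/
noncomputable def signedAdj (M : Finset (Fin n)) : Module.End ℝ ((Fin n → Bool) → ℝ) where
  toFun v x := ∑ i ∈ M, edgeSign i x * v (flipOn x {i})
  map_add' v w := by funext x; simp [mul_add, sum_add_distrib]
  map_smul' c v := by
    funext x; simp only [Pi.smul_apply, smul_eq_mul, RingHom.id_apply, mul_sum]
    exact sum_congr rfl fun i _ => by ring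

theorem signedAdj_apply (M : Finset (Fin n)) (v : (Fin n → Bool) → ℝ) (x : Fin n → Bool) :
    signedAdj M v x = ∑ i ∈ M, edgeSign i x * v (flipOn x {i}) := rfl

/-- The signed adjacency operator squares to `|M|`, because the paths `x → xⁱ → xⁱʲ` and
`x → xʲ → xⁱʲ` have opposite signs. -/
theorem signedAdj_signedAdj (M : Finset (Fin n)) (v : (Fin n → Bool) → ℝ) :
    signedAdj M (signedAdj M v) = (#M : ℝ) • v := by
  funext x
  let g : Fin n → Fin n → ℝ := fun i j =>
    edgeSign i x * (edgeSign j (flipOn x {i}) * v (flipOn (flipOn x {i}) {j}))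
  have hg : ∀ i j, g i j + g j i = if i = j then 2 * v x else 0 := by
    intro i j
    simp only [g]
    rw [flipOn_comm x {j} {i}, edgeSign_flipOn, edgeSign_flipOn]
    rcases lt_trichotomy i j with h | rfl | h
    · rw [if_pos h, if_neg h.not_gt, if_neg h.ne]; ring
    · rw [if_neg (lt_irrefl i), if_pos rfl, flipOn_flipOn_self]
      linear_combination (2 * v x) * edgeSign_mul_self i x
    · rw [if_neg h.not_gt, if_pos h, if_neg h.ne']; ring
  have hsum : signedAdj M (signedAdj M v) x = ∑ i ∈ M, ∑ j ∈ M, g i j := by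
    simp only [signedAdj_apply, mul_sum, g]
  have h2 : (∑ i ∈ M, ∑ j ∈ M, g i j) + ∑ i ∈ M, ∑ j ∈ M, g i j = 2 * (#M * v x) := by
    conv_lhs => rw [add_comm]; arg 1; rw [sum_comm]
    rw [← sum_add_distrib]
    simp only [← sum_add_distrib]
    rw [sum_congr rfl fun i _ => sum_congr rfl fun j _ => hg j i]
    simp only [sum_ite_eq', sum_ite_mem, inter_self, sum_const, nsmul_eq_mul]
    ring
  rw [hsum, Pi.smul_apply, smul_eq_mul]
  linarith

/-- The functions supported on more than half of the cube form a space that meets one of the two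
eigenspaces of the signed adjacency operator. -/
theorem exists_eigenvector_supported {M : Finset (Fin n)} (hM : M.Nonempty)
    {H : Finset (Fin n → Bool)} (hH : 2 ^ n < 2 * #H) :
    ∃ v : (Fin n → Bool) → ℝ, v ≠ 0 ∧ (∀ x ∉ H, v x = 0) ∧
      ∃ μ : ℝ, |μ| = √(#M) ∧ signedAdj M v = μ • v := by
  set r : ℝ := √(#M) with hr
  have hr0 : 0 < r := Real.sqrt_pos.2 (by exact_mod_cast hM.card_pos)
  have hrr : r * r = #M := Real.mul_self_sqrt (Nat.cast_nonneg _)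
  let V := (Fin n → Bool) → ℝ
  let E : ℝ → Submodule ℝ V := fun μ => LinearMap.ker (signedAdj M - μ • LinearMap.id)
  have hE : ∀ μ v, v ∈ E μ ↔ signedAdj M v = μ • v := by
    intro μ v
    simp [E, LinearMap.mem_ker, sub_eq_zero]
  let W : Submodule ℝ V := LinearMap.ker (LinearMap.funLeft ℝ ℝ ((↑) : {x // x ∉ H} → _))
  have hW : ∀ v, v ∈ W ↔ ∀ x ∉ H, v x = 0 := by
    intro v
    simp only [W, LinearMap.mem_ker]
    constructor
    · intro h x hx
      exact congrFun h ⟨x, hx⟩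
    · intro h
      funext x
      exact h x x.2
  have hV : Module.finrank ℝ V = 2 ^ n := by simp [V]
  have hWdim : #H ≤ Module.finrank ℝ W := by
    have h1 := LinearMap.finrank_range_add_finrank_ker
      (LinearMap.funLeft ℝ ℝ ((↑) : {x // x ∉ H} → (Fin n → Bool)))
    have h2 := Submodule.finrank_le (LinearMap.range
      (LinearMap.funLeft ℝ ℝ ((↑) : {x // x ∉ H} → (Fin n → Bool))))
    have h3 : Module.finrank ℝ ({x // x ∉ H} → ℝ) = 2 ^ n - #H := by
      rw [Module.finrank_fintype_fun_eq_card, Fintype.card_subtype_compl]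
      simp
    have h4 : #H ≤ 2 ^ n := by simpa using card_le_univ H
    change _ = Module.finrank ℝ V at h1
    change _ + Module.finrank ℝ W = _ at h1
    omega
  have htop : E r ⊔ E (-r) = ⊤ := by
    rw [eq_top_iff]
    intro v _
    have hsq := signedAdj_signedAdj M v
    rw [← hrr] at hsq
    have hv : v = (2 * r)⁻¹ • (r • v + signedAdj M v) + (2 * r)⁻¹ • (r • v - signedAdj M v) := by
      rw [← smul_add, add_add_sub_cancel, ← add_smul, smul_smul, ← two_mul,
        inv_mul_cancel₀ (by positivity), one_smul]
    rw [hv]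
    refine Submodule.add_mem_sup (Submodule.smul_mem _ _ ((hE _ _).2 ?_))
      (Submodule.smul_mem _ _ ((hE _ _).2 ?_))
    · rw [map_add, map_smul, hsq]; module
    · rw [map_sub, map_smul, hsq]; module
  have hdim : 2 ^ n ≤ Module.finrank ℝ (E r) + Module.finrank ℝ (E (-r)) := by
    rw [← hV, ← finrank_top ℝ V, ← htop]
    exact Submodule.finrank_add_le_finrank_add_finrank _ _
  have hmeet : ∀ μ, 2 ^ n ≤ 2 * Module.finrank ℝ (E μ) → ∃ v, v ≠ 0 ∧ v ∈ E μ ∧ v ∈ W := by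
    intro μ hμ
    have h1 := Submodule.finrank_sup_add_finrank_inf_eq (E μ) W
    have h2 := Submodule.finrank_le (E μ ⊔ W)
    rw [hV] at h2
    have h3 : 0 < Module.finrank ℝ ↥(E μ ⊓ W) := by omega
    have h4 : E μ ⊓ W ≠ ⊥ := by
      intro h
      rw [h, finrank_bot] at h3
      exact lt_irrefl _ h3
    obtain ⟨v, hv, hv0⟩ := Submodule.exists_mem_ne_zero_of_ne_bot h4
    exact ⟨v, hv0, hv.1, hv.2⟩
  have hor : ∃ μ, |μ| = r ∧ 2 ^ n ≤ 2 * Module.finrank ℝ (E μ) := by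
    by_cases h : 2 ^ n ≤ 2 * Module.finrank ℝ (E r)
    · exact ⟨r, abs_of_pos hr0, h⟩
    · exact ⟨-r, by rw [abs_neg, abs_of_pos hr0], by omega⟩
  obtain ⟨μ, hμ, hle⟩ := hor
  obtain ⟨v, hv0, hvE, hvW⟩ := hmeet μ hle
  exact ⟨v, hv0, (hW v).1 hvW, μ, hμ, (hE μ v).1 hvE⟩

/-- On more than half of the cube, `(-1) ^ f` and the alternating sum have equal signs, because the
two functions are positively correlated and both have constant modulus. -/
theorem IsMaximalMonomial.two_pow_lt_two_mul_card {f : (Fin n → Bool) → Bool}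
    {M : Finset (Fin n)} (hM : IsMaximalMonomial f M) :
    2 ^ n < 2 * #{x | 0 < altSum f M x * sgn (f x)} := by
  have hcorr : 2 ^ #M * ∑ x, altSum f M x * sgn (f x) = ∑ x, altSum f M x * altSum f M x := by
    calc 2 ^ #M * ∑ x, altSum f M x * sgn (f x)
        = ∑ S ∈ M.powerset, ∑ x, altSum f M (flipOn x S) * sgn (f (flipOn x S)) := by
          rw [sum_congr rfl fun S _ => sum_flipOn (fun x => altSum f M x * sgn (f x)) S]
          simp
      _ = ∑ x, altSum f M x * altSum f M x := by
          rw [sum_comm]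
          refine sum_congr rfl fun x _ => ?_
          conv_rhs => rw [altSum.eq_1 f M x, sum_mul]
          refine sum_congr rfl fun S hS => ?_
          rw [altSum_flipOn_of_subset f (mem_powerset.1 hS)]
          simp only [altSum]
          ring
  set K := |altSum f M fun _ => false| with hK
  have hK0 : 0 < K := abs_pos.2 (hM.altSum_ne_zero _)
  have hpos : 0 < ∑ x, altSum f M x * sgn (f x) := by
    have : 0 < ∑ x, altSum f M x * altSum f M x :=
      sum_pos (fun x _ => mul_self_pos.2 (hM.altSum_ne_zero x)) univ_nonempty
    rw [← hcorr] at this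
    exact pos_of_mul_pos_right this (by positivity)
  have hval : ∀ x, altSum f M x * sgn (f x) =
      2 * (if 0 < altSum f M x * sgn (f x) then K else 0) - K := by
    intro x
    have h : |altSum f M x * sgn (f x)| = K := by
      rw [abs_mul, hM.abs_altSum_eq x fun _ => false]
      cases f x <;> simp [sgn, hK]
    split_ifs with h0
    · rw [abs_of_pos h0] at h; linarith
    · rw [abs_of_nonpos (not_lt.1 h0)] at h; linarith
  rw [sum_congr rfl fun x _ => hval x, sum_sub_distrib, ← mul_sum, ← sum_filter] at hpos
  simp only [sum_const, nsmul_eq_mul, card_univ, Fintype.card_fun, Fintype.card_bool,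
    Fintype.card_fin] at hpos
  have : ((2 ^ n : ℕ) : ℝ) * K < (2 * #{x | 0 < altSum f M x * sgn (f x)} : ℕ) * K := by
    push_cast at hpos ⊢
    linarith
  exact_mod_cast lt_of_mul_lt_mul_right this hK0.le

/-- Huang's theorem in weighted form: the graph of sensitive edges in the directions of a maximal
monomial `M` has spectral norm at least `√|M|`, as a non-negative vector `w` witnesses. -/
theorem IsMaximalMonomial.exists_weights {f : (Fin n → Bool) → Bool}
    {M : Finset (Fin n)} (hM : IsMaximalMonomial f M) (hne : M.Nonempty) :
    ∃ w : (Fin n → Bool) → ℝ, (∀ x, 0 ≤ w x) ∧ 0 < ∑ x, w x ^ 2 ∧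
      √(#M) * ∑ x, w x ^ 2 ≤
        ∑ x, ∑ i ∈ M, if f (flipOn x {i}) ≠ f x then w x * w (flipOn x {i}) else 0 := by
  obtain ⟨v, hv0, hvH, μ, hμ, hv⟩ := exists_eigenvector_supported hne hM.two_pow_lt_two_mul_card
  refine ⟨fun x => |v x|, fun x => abs_nonneg _, ?_, ?_⟩
  · obtain ⟨x, hx⟩ := Function.ne_iff.1 hv0
    exact sum_pos' (fun x _ => by positivity) ⟨x, mem_univ _, pow_pos (abs_pos.2 hx) 2⟩
  · -- The alternating sum changes sign along an edge in a direction of `M`, so an edge inside the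
    -- support of `v` is sensitive.
    have hedge : ∀ x, ∀ i ∈ M, |v x| * |v (flipOn x {i})| =
        if f (flipOn x {i}) ≠ f x then |v x| * |v (flipOn x {i})| else 0 := by
      intro x i hi
      split_ifs with h
      · rfl
      · push Not at h
        by_contra hne
        have h1 : 0 < altSum f M x * sgn (f x) := by
          by_contra hx
          exact hne (by rw [hvH x (by simpa using hx)]; simp)
        have h2 : 0 < altSum f M (flipOn x {i}) * sgn (f (flipOn x {i})) := by
          by_contra hx
          exact hne (by rw [hvH (flipOn x {i}) (by simpa using hx)]; simp)
        rw [h, altSum_flipOn_singleton f hi] at h2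
        linarith
    rw [mul_sum]
    refine sum_le_sum fun x _ => ?_
    calc √(#M) * |v x| ^ 2 = |v x| * |signedAdj M v x| := by
          rw [hv, Pi.smul_apply, smul_eq_mul, abs_mul, hμ]; ring
      _ ≤ |v x| * ∑ i ∈ M, |v (flipOn x {i})| := by
          rw [signedAdj_apply]
          gcongr
          refine (abs_sum_le_sum_abs _ _).trans_eq (sum_congr rfl fun i _ => ?_)
          rw [abs_mul, abs_edgeSign, one_mul]
      _ = _ := by
          rw [mul_sum]
          exact sum_congr rfl (hedge x)

/-! ### The adversary bound for quantum algorithms -/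

section Quantum

variable {w : ℕ}

/-- The real part of the inner product of two states. -/
noncomputable def reInner (ψ φ : Basis n w → ℂ) : ℝ := ∑ s, (star (ψ s) * φ s).re

theorem reInner_eq (ψ φ : Basis n w → ℂ) : reInner ψ φ = (star ψ ⬝ᵥ φ).re := by
  simp [reInner, dotProduct]

theorem reInner_self (ψ : Basis n w → ℂ) : reInner ψ ψ = ∑ s, ‖ψ s‖ ^ 2 :=
  sum_congr rfl fun s _ => by
    rw [← Complex.normSq_eq_norm_sq, Complex.star_def, ← Complex.normSq_eq_conj_mul_self,
      Complex.ofReal_re]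

theorem reInner_mulVec (U : Matrix.unitaryGroup (Basis n w) ℂ) (ψ φ : Basis n w → ℂ) :
    reInner (Matrix.mulVec U.1 ψ) (Matrix.mulVec U.1 φ) = reInner ψ φ := by
  have hU : U.1.conjTranspose * U.1 = 1 := Matrix.mem_unitaryGroup_iff'.1 U.2
  rw [reInner_eq, reInner_eq, Matrix.star_mulVec, Matrix.dotProduct_mulVec,
    Matrix.vecMul_vecMul, hU, Matrix.vecMul_one]

/-- The permutation of the basis states by which the query unitary acts. -/
def oraclePerm (x : Fin n → Bool) : Equiv.Perm (Basis n w) :=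
  Function.Involutive.toPerm (fun s => (s.1, xor s.2.1 (s.1.elim false x), s.2.2))
    (fun s => by simp)

theorem reInner_oracle (x : Fin n → Bool) (ψ φ : Basis n w → ℂ) :
    reInner (oracle x ψ) (oracle x φ) = reInner ψ φ :=
  Equiv.sum_comp (oraclePerm x) fun s => (star (ψ s) * φ s).re

/-- The probability that a measurement of the index register of `ψ` gives `i`. -/
noncomputable def queryWeight (ψ : Basis n w → ℂ) (i : Fin n) : ℝ :=
  ∑ s, if s.1 = some i then ‖ψ s‖ ^ 2 else 0

theorem queryWeight_nonneg (ψ : Basis n w → ℂ) (i : Fin n) : 0 ≤ queryWeight ψ i :=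
  sum_nonneg fun s _ => by split_ifs <;> positivity

theorem queryWeight_oracle (x : Fin n → Bool) (ψ : Basis n w → ℂ) (i : Fin n) :
    queryWeight (oracle x ψ) i = queryWeight ψ i :=
  Equiv.sum_comp (oraclePerm x) fun s => if s.1 = some i then ‖ψ s‖ ^ 2 else 0

theorem sum_queryWeight_eq (ψ : Basis n w → ℂ) (B : Finset (Fin n)) :
    ∑ i ∈ B, queryWeight ψ i = ∑ s, if ∃ i ∈ B, s.1 = some i then ‖ψ s‖ ^ 2 else 0 := by
  simp only [queryWeight]
  rw [sum_comm]
  refine sum_congr rfl fun s _ => ?_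
  obtain ⟨_ | j, c⟩ := s
  · simp
  · simp

theorem sum_queryWeight_le (ψ : Basis n w → ℂ) (B : Finset (Fin n)) :
    ∑ i ∈ B, queryWeight ψ i ≤ ∑ s, ‖ψ s‖ ^ 2 := by
  rw [sum_queryWeight_eq]
  exact sum_le_sum fun s _ => by split_ifs <;> simp

/-- A query to inputs that differ only in `B` decreases the inner product by at most twice the
geometric mean of the query weights on `B`. This is stated as an arithmetic mean with free weights
`u` and `v`, so that it can be summed over pairs of inputs. -/
theorem reInner_sub_reInner_oracle_le {x y : Fin n → Bool} {B : Finset (Fin n)}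
    (hB : ∀ i ∉ B, x i = y i) (ψ φ : Basis n w → ℂ) (u v : ℝ) (hu : 0 ≤ u) (hv : 0 ≤ v) :
    u * v * (reInner ψ φ - reInner (oracle x ψ) (oracle y φ)) ≤
      u ^ 2 * ∑ i ∈ B, queryWeight ψ i + v ^ 2 * ∑ i ∈ B, queryWeight φ i := by
  rw [← reInner_oracle x ψ φ]
  have hψ : ∑ i ∈ B, queryWeight ψ i = ∑ i ∈ B, queryWeight (oracle x ψ) i := by
    simp only [queryWeight_oracle]
  have hφ : v ^ 2 * ∑ i ∈ B, queryWeight φ i =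
      v ^ 2 / 2 * ∑ i ∈ B, queryWeight (oracle x φ) i +
        v ^ 2 / 2 * ∑ i ∈ B, queryWeight (oracle y φ) i := by
    simp only [queryWeight_oracle]; ring
  rw [hψ, hφ]
  simp only [sum_queryWeight_eq, reInner]
  rw [← sum_sub_distrib, mul_sum, mul_sum, mul_sum, mul_sum, ← sum_add_distrib,
    ← sum_add_distrib]
  refine sum_le_sum fun s _ => ?_
  split_ifs with hs
  · have h1 : (star (oracle x ψ s) * oracle x φ s).re ≤ ‖oracle x ψ s‖ * ‖oracle x φ s‖ := by
      refine (Complex.re_le_norm _).trans_eq ?_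
      rw [norm_mul, norm_star]
    have h2 : -(star (oracle x ψ s) * oracle y φ s).re ≤ ‖oracle x ψ s‖ * ‖oracle y φ s‖ := by
      refine (neg_le_abs _).trans ((Complex.abs_re_le_norm _).trans_eq ?_)
      rw [norm_mul, norm_star]
    calc u * v * ((star (oracle x ψ s) * oracle x φ s).re -
          (star (oracle x ψ s) * oracle y φ s).re)
        ≤ u * v * (‖oracle x ψ s‖ * ‖oracle x φ s‖ + ‖oracle x ψ s‖ * ‖oracle y φ s‖) := by
          gcongr; linarith
      _ ≤ _ := by
          nlinarith [sq_nonneg (u * ‖oracle x ψ s‖ - v * ‖oracle x φ s‖),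
            sq_nonneg (u * ‖oracle x ψ s‖ - v * ‖oracle y φ s‖)]
  · have : oracle x φ s = oracle y φ s := by
      obtain ⟨_ | j, c⟩ := s
      · rfl
      · have hj : j ∉ B := fun h => hs ⟨j, h, rfl⟩
        simp [oracle, hB j hj]
    rw [this]
    simp

/-- States that are told apart with error `1/3` have inner product at most `17/18`. (The optimal
bound is `2√2/3`.) -/
theorem reInner_le_of_distinguished {ψ φ : Basis n w → ℂ} (hψ : ∑ s, ‖ψ s‖ ^ 2 = 1)
    (hφ : ∑ s, ‖φ s‖ ^ 2 = 1) (p : Basis n w → Prop) [DecidablePred p]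
    (hp : 2 / 3 ≤ ∑ s, if p s then ‖ψ s‖ ^ 2 else 0)
    (hq : 2 / 3 ≤ ∑ s, if p s then 0 else ‖φ s‖ ^ 2) : reInner ψ φ ≤ 17 / 18 := by
  -- AM-GM with the ratio `3/4`, a rational approximation of the optimal `1/√2`.
  have key : ∀ s, (star (ψ s) * φ s).re ≤
      2 / 3 * ‖ψ s‖ ^ 2 - 7 / 24 * (if p s then ‖ψ s‖ ^ 2 else 0) +
        (2 / 3 * ‖φ s‖ ^ 2 - 7 / 24 * if p s then 0 else ‖φ s‖ ^ 2) := by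
    intro s
    have h : (star (ψ s) * φ s).re ≤ ‖ψ s‖ * ‖φ s‖ := by
      refine (Complex.re_le_norm _).trans_eq ?_
      rw [norm_mul, norm_star]
    split_ifs
    · nlinarith [sq_nonneg (3 * ‖ψ s‖ - 4 * ‖φ s‖)]
    · nlinarith [sq_nonneg (4 * ‖ψ s‖ - 3 * ‖φ s‖)]
  have := sum_le_sum fun s (_ : s ∈ univ) => key s
  rw [sum_add_distrib, sum_sub_distrib, sum_sub_distrib] at this
  simp only [← mul_sum, hψ, hφ] at this
  rw [reInner]
  linarith

variable (A : QuantumAlgorithm n w)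

theorem QuantumAlgorithm.reInner_state_zero (x y : Fin n → Bool) :
    reInner (A.state x 0) (A.state y 0) = 1 := by
  rw [QuantumAlgorithm.state, QuantumAlgorithm.state, reInner_mulVec, reInner_self,
    Fintype.sum_eq_single (none, false, fun _ => false)]
  · simp [initState]
  · intro s hs
    simp [initState, Pi.single_eq_of_ne hs]

theorem QuantumAlgorithm.sum_norm_sq_state (x : Fin n → Bool) (t : ℕ) :
    ∑ s, ‖A.state x t s‖ ^ 2 = 1 := by
  rw [← reInner_self]
  induction t with
  | zero => exact A.reInner_state_zero x x
  | succ t ih => rw [QuantumAlgorithm.state, reInner_mulVec, reInner_oracle, ih]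

/-- The adversary bound for one pair of inputs: to tell apart two inputs that differ only in `B`,
the algorithm needs query weight on `B`. The weights `u` and `v` distribute the burden between the
two inputs. -/
theorem QuantumAlgorithm.le_sum_queryWeight {f : (Fin n → Bool) → Bool} {T : ℕ}
    (hA : ∀ x, 2 / 3 ≤ A.outputProb T x (f x)) {x y : Fin n → Bool} (hxy : f y ≠ f x)
    {B : Finset (Fin n)} (hB : ∀ i ∉ B, x i = y i) {u v : ℝ} (hu : 0 ≤ u) (hv : 0 ≤ v) :
    u * v / 18 ≤ ∑ t ∈ range T, (u ^ 2 * ∑ i ∈ B, queryWeight (A.state x t) i +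
      v ^ 2 * ∑ i ∈ B, queryWeight (A.state y t) i) := by
  have hprog : ∀ t, u * v * (1 - reInner (A.state x t) (A.state y t)) ≤
      ∑ t ∈ range t, (u ^ 2 * ∑ i ∈ B, queryWeight (A.state x t) i +
        v ^ 2 * ∑ i ∈ B, queryWeight (A.state y t) i) := by
    intro t
    induction t with
    | zero => simp [A.reInner_state_zero]
    | succ t ih =>
      rw [sum_range_succ, QuantumAlgorithm.state, QuantumAlgorithm.state, reInner_mulVec]
      have := reInner_sub_reInner_oracle_le hB (A.state x t) (A.state y t) u v hu hv
      linarith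
  have hend : reInner (A.state x T) (A.state y T) ≤ 17 / 18 := by
    refine reInner_le_of_distinguished (A.sum_norm_sq_state x T) (A.sum_norm_sq_state y T)
      (fun s => A.out s = f x) (hA x) ((hA y).trans_eq ?_)
    refine sum_congr rfl fun s _ => ?_
    have : A.out s = f y ↔ ¬ A.out s = f x := by
      cases hx : f x <;> cases hy : f y <;> simp_all
    by_cases h : A.out s = f x
    · rw [if_neg fun e => this.1 e h, if_pos h]
    · rw [if_pos (this.2 h), if_neg h]
  refine le_trans ?_ (hprog T)
  have := mul_nonneg hu hv
  nlinarith

theorem QuantumAlgorithm.sum_queryWeight_le_one (x : Fin n → Bool) (t : ℕ) (B : Finset (Fin n)) :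
    ∑ i ∈ B, queryWeight (A.state x t) i ≤ 1 :=
  (sum_queryWeight_le _ B).trans_eq (A.sum_norm_sq_state x t)

end Quantum

/-! ### Lower bounds on the number of quantum queries -/

theorem le_mul_sq_of_sqrt_le {k T : ℕ} (h : √(k : ℝ) ≤ 36 * T) : k ≤ 1296 * T ^ 2 := by
  have h' := (Real.sqrt_le_left (by positivity)).1 h
  have : (k : ℝ) ≤ (1296 * T ^ 2 : ℕ) := by push_cast; linarith
  exact_mod_cast this

/-- The bound `bs(f) = O(Q(f)²)`. The weight `√k : 1` on the pair of `x` and the `j`-th of `k`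
neighbours reflects that the queries to `x` are shared by all disjoint blocks. -/
theorem QuantumComputable.blockSensitivityLE {f : (Fin n → Bool) → Bool} {T : ℕ}
    (hf : QuantumComputable f T) : BlockSensitivityLE f (1296 * T ^ 2) := by
  obtain ⟨w, A, hA⟩ := hf
  intro k x B hB hs
  refine le_mul_sq_of_sqrt_le ?_
  rcases Nat.eq_zero_or_pos k with rfl | hk
  · simp
  have hk' : (0 : ℝ) < k := by exact_mod_cast hk
  have hpair : ∀ j, √(k : ℝ) / 18 ≤
      ∑ t ∈ range T, (k * ∑ i ∈ B j, queryWeight (A.state x t) i + 1) := by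
    intro j
    have h := A.le_sum_queryWeight hA (hs j) (B := B j) (fun i hi => by simp [flipOn, hi])
      (Real.sqrt_nonneg k) zero_le_one
    rw [mul_one, Real.sq_sqrt hk'.le] at h
    refine h.trans (sum_le_sum fun t _ => ?_)
    have := A.sum_queryWeight_le_one (flipOn x (B j)) t (B j)
    linarith
  have hsum : k * (√(k : ℝ) / 18) ≤ ∑ t ∈ range T, (2 * k : ℝ) := by
    calc k * (√(k : ℝ) / 18) = ∑ _j : Fin k, √(k : ℝ) / 18 := by simp
      _ ≤ ∑ j, ∑ t ∈ range T, (k * ∑ i ∈ B j, queryWeight (A.state x t) i + 1) :=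
          sum_le_sum fun j _ => hpair j
      _ ≤ ∑ t ∈ range T, (2 * k : ℝ) := by
          rw [sum_comm]
          refine sum_le_sum fun t _ => ?_
          rw [sum_add_distrib, ← mul_sum, ← sum_biUnion fun i _ j _ hij => hB hij]
          have := A.sum_queryWeight_le_one x t (univ.biUnion B)
          simp only [sum_const, card_univ, Fintype.card_fin, nsmul_eq_mul, mul_one]
          nlinarith
  simp only [sum_const, card_range, nsmul_eq_mul] at hsum
  nlinarith

/-- The bound `deg(f) = O(Q(f)²)`, by the adversary method for the graph of sensitive edges in the
directions of `M`. -/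
theorem QuantumComputable.card_le_of_isMaximalMonomial {f : (Fin n → Bool) → Bool} {T : ℕ}
    (hf : QuantumComputable f T) {M : Finset (Fin n)} (hM : IsMaximalMonomial f M) :
    #M ≤ 1296 * T ^ 2 := by
  obtain ⟨w, A, hA⟩ := hf
  rcases M.eq_empty_or_nonempty with rfl | hne
  · simp
  obtain ⟨v, hv, hpos, hle⟩ := hM.exists_weights hne
  refine le_mul_sq_of_sqrt_le ?_
  let q : ℕ → Fin n → (Fin n → Bool) → ℝ := fun t i x => v x ^ 2 * queryWeight (A.state x t) i
  have hq : ∀ t i x, 0 ≤ q t i x := fun t i x =>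
    mul_nonneg (sq_nonneg _) (queryWeight_nonneg _ _)
  have hpair : ∀ x, ∀ i ∈ M,
      (if f (flipOn x {i}) ≠ f x then v x * v (flipOn x {i}) else 0) / 18 ≤
        ∑ t ∈ range T, (q t i x + q t i (flipOn x {i})) := by
    intro x i _
    split_ifs with h
    · have := A.le_sum_queryWeight hA h (B := {i})
        (fun j hj => by simp [flipOn, notMem_singleton.1 hj]) (hv x) (hv (flipOn x {i}))
      simpa only [sum_singleton] using this
    · rw [zero_div]
      exact sum_nonneg fun t _ => add_nonneg (hq _ _ _) (hq _ _ _)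
  have hsum : √(#M) * (∑ x, v x ^ 2) / 18 ≤ ∑ t ∈ range T, 2 * ∑ x, v x ^ 2 := by
    calc √(#M) * (∑ x, v x ^ 2) / 18
        ≤ (∑ x, ∑ i ∈ M, if f (flipOn x {i}) ≠ f x then v x * v (flipOn x {i}) else 0) / 18 := by
          gcongr
      _ ≤ ∑ x, ∑ i ∈ M, ∑ t ∈ range T, (q t i x + q t i (flipOn x {i})) := by
          simp only [sum_div]
          exact sum_le_sum fun x _ => sum_le_sum fun i hi => hpair x i hi
      _ = ∑ t ∈ range T, ∑ i ∈ M, ∑ x, (q t i x + q t i (flipOn x {i})) := by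
          rw [sum_comm, sum_congr rfl fun i _ => sum_comm, sum_comm]
      _ ≤ ∑ t ∈ range T, 2 * ∑ x, v x ^ 2 := by
          refine sum_le_sum fun t _ => ?_
          rw [sum_congr rfl fun i _ => by rw [sum_add_distrib, sum_flipOn (q t i), ← two_mul],
            ← mul_sum, sum_comm]
          refine mul_le_mul_of_nonneg_left (sum_le_sum fun x _ => ?_) zero_le_two
          rw [← mul_sum]
          exact mul_le_of_le_one_right (sq_nonneg _) (A.sum_queryWeight_le_one x t M)
  simp only [sum_const, card_range, nsmul_eq_mul] at hsum
  refine le_of_mul_le_mul_right ?_ hpos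
  linarith

end QueryComplexity

theorem theorem1 :
    ∃ C : ℕ, ∀ (n : ℕ) (f : (Fin n → Bool) → Bool),
      QueryComplexity.D f ≤ C * QueryComplexity.Q f ^ 4 := by
  refine ⟨1296 ^ 2, fun n f => ?_⟩
  have hQ := QueryComplexity.quantumComputable_Q f
  refine (Nat.sInf_le (QueryComplexity.detComputable_mul
    (d := 1296 * QueryComplexity.Q f ^ 2) _ f (fun M x h => ?_)
    hQ.blockSensitivityLE)).trans_eq (by ring)
  obtain ⟨M', hMM', hM'⟩ := QueryComplexity.exists_isMaximalMonomial_superset h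
  exact (Finset.card_le_card hMM').trans (hQ.card_le_of_isMaximalMonomial hM')
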